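/- Let $d\ge 1$, $M>0$, $\bar\lambda\in(0,1)$, and let $\phi$ be a known probability density on $\mathbb{R}^d$ (with respect to Lebesgue measure). Write $\|\cdot\|$ for the Euclidean norm, $\|\mu\|_\infty=\max_j|\mu^{(j)}|$, $\phi_\mu(x)=\phi(x-\mu)$ and $f_{\lambda,\mu}=(1-\lambda)\phi+\lambda\phi_\mu$. Assume * $(H_S)$: $\phi\in\mathcal{C}^3(\mathbb{R}^d)\cap\mathbb{L}^2(\mathbb{R}^d)$; * $(H_{Lip})$: there is $g\in\mathbb{L}^2(\mathbb{R}^d)$ such that $|\phi(x)-\phi_\mu(x)|\le\|\mu\|\,g(x)$ for all $x\in\mathbb{R}^d$ and all $\mu\in[-M,M]^d$, and $\int_{\mathbb{R}^d} g^2(x)\,\phi^{-1}(x)\,dx<\infty$. For $n\ge 1$ let $\mathcal{M}_n$ be the finite grid of all $(\lambda,\mu)$ with $\lambda=i/\sqrt n$ and $\mu^{(j)}=\pm k_j/\sqrt n$ ($1\le j\le d$), where $i$ and the $k_j$ are integers with $1\le i\le\sqrt n$ and $1\le k_j\le M\sqrt n$ and the signs are free. Given an i.i.d. sample $X_1,\dots,X_n$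 with density $f_{\lambda^\star,\mu^\star}$, and whenever $\mathcal{M}_n$ is non-empty, let $(\hat\lambda_n,\hat\mu_n)$ be a (measurable) minimizer over $(\lambda,\mu)\in\mathcal{M}_n$ of $$\gamma_n(\lambda,\mu)=-\frac2n\sum_{i=1}^n f_{\lambda,\mu}(X_i)+\int_{\mathbb{R}^d} f_{\lambda,\mu}(x)^2\,dx .$$ Let $(\ell_n)_n$ be a real sequence with $\ell_n/\log n\to+\infty$, and let $$\Theta_n=\Big\{(\lambda,\mu)\in(0,1)\times(\mathbb{R}^d\setminus\{0\})\ :\ \frac{\ell_n}{\|\mu\|^2\sqrt n}\le\lambda\le\bar\lambda,\ \|\mu\|_\infty\le M\Big\}.$$ Then there is a constant $C_2>0$ (depending only on $d$, $M$, $\bar\lambda$, $\phi$ and the sequence $(\ell_n)_n$) such that for every $n\ge 2$ for which $\mathcal{M}_n$ is non-empty and every such minimizer, $$\sup_{(\lambda^\star,\mu^\star)\in\Theta_n}\mathbb{E}_{\lambda^\star,\mu^\star}\Big[\|\mu^\star\|^4(\hat\lambda_n-\lambda^\star)^2\Big]\le\frac{C_2\log^2 n}{n}.$$ -/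

import Mathlib

open MeasureTheory Filter

noncomputable section

namespace Contamination

/-- `ℝ^d` with the Euclidean norm and Lebesgue measure. -/
abbrev E (d : ℕ) : Type := EuclideanSpace ℝ (Fin d)

/-- `φ` is a probability density with respect to Lebesgue measure on `ℝ^d`. -/
structure IsProbDensity {d : ℕ} (φ : E d → ℝ) : Prop where
  nonneg : ∀ x, 0 ≤ φ x
  integrable : Integrable φ volume
  integral_eq_one : ∫ x, φ x = 1

/-- The cube `[-M, M]^d`, that is, `‖μ‖_∞ ≤ M`. -/
def cube (d : ℕ) (M : ℝ) : Set (E d) := {μ | ∀ j, |μ j| ≤ M}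

/-- Smoothness assumption: `φ` is three times continuously differentiable and square integrable. -/
def SmoothAssumption {d : ℕ} (φ : E d → ℝ) : Prop :=
  ContDiff ℝ 3 φ ∧ MemLp φ 2 volume

/-- Lipschitz assumption over the cube `[-M, M]^d`. The integral of `g ^ 2 / φ` is taken in
`[0, ∞]`, with `1 / 0 = ∞` and `0 * ∞ = 0`. -/
def LipAssumption {d : ℕ} (M : ℝ) (φ : E d → ℝ) : Prop :=
  ∃ g : E d → ℝ, MemLp g 2 volume ∧
    (∀ x, ∀ μ ∈ cube d M, |φ x - φ (x - μ)| ≤ ‖μ‖ * g x) ∧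
    ∫⁻ x, ENNReal.ofReal (g x ^ 2) * (ENNReal.ofReal (φ x))⁻¹ < ⊤

/-- The contamination mixture `f_{lam, μ} = (1 - lam) φ + lam φ(· - μ)`. -/
def mixture {d : ℕ} (φ : E d → ℝ) (lam : ℝ) (μ : E d) (x : E d) : ℝ :=
  (1 - lam) * φ x + lam * φ (x - μ)

/-- The law of an i.i.d. sample of size `n` from the density `f_{lam, μ}`. -/
def sampleLaw {d : ℕ} (φ : E d → ℝ) (lam : ℝ) (μ : E d) (n : ℕ) : Measure (Fin n → E d) :=
  Measure.pi fun _ => volume.withDensity fun x => ENNReal.ofReal (mixture φ lam μ x)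

/-- The grid of pairs `(i / √n, (± k_1 / √n, …, ± k_d / √n))` with integers
`1 ≤ i ≤ √n` and `1 ≤ k_j ≤ M √n`, the signs being free. -/
def grid (d : ℕ) (M : ℝ) (n : ℕ) : Set (ℝ × E d) :=
  {p | (∃ i : ℕ, 1 ≤ i ∧ (i : ℝ) ≤ √(n : ℝ) ∧ p.1 = i / √(n : ℝ)) ∧
    ∀ j, ∃ k : ℕ, 1 ≤ k ∧ (k : ℝ) ≤ M * √(n : ℝ) ∧
      (p.2 j = k / √(n : ℝ) ∨ p.2 j = -(k / √(n : ℝ)))}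

/-- The empirical `L²` contrast
`γ_n(lam, μ) = -(2 / n) ∑ f_{lam, μ}(X_i) + ‖f_{lam, μ}‖₂²`. -/
def contrast {d n : ℕ} (φ : E d → ℝ) (X : Fin n → E d) (p : ℝ × E d) : ℝ :=
  -(2 / (n : ℝ)) * ∑ i, mixture φ p.1 p.2 (X i) + ∫ x, mixture φ p.1 p.2 x ^ 2

/-- `est = (lamHat, muHat)` is a (measurable) minimizer of the contrast over the grid. -/
structure IsContrastEstimator {d : ℕ} (M : ℝ) (φ : E d → ℝ) (n : ℕ)
    (est : (Fin n → E d) → ℝ × E d) : Prop where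
  measurable : Measurable est
  mem_grid : ∀ X, est X ∈ grid d M n
  isMin : ∀ X, ∀ p ∈ grid d M n, contrast φ X (est X) ≤ contrast φ X p

/-- The parameters `(lam, μ) ∈ (0, 1) × [-M, M]^d` with
`ℓ_n / (‖μ‖² √n) ≤ lam ≤ lamBar`; `ln` stands for `ℓ_n`. The fraction presupposes `μ ≠ 0`. -/
def paramSet (d : ℕ) (M lamBar ln : ℝ) (n : ℕ) : Set (ℝ × E d) :=
  {θ | 0 < θ.1 ∧ θ.1 < 1 ∧ θ.2 ≠ 0 ∧ ln / (‖θ.2‖ ^ 2 * √(n : ℝ)) ≤ θ.1 ∧ θ.1 ≤ lamBar ∧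
    θ.2 ∈ cube d M}

end Contamination

end

namespace Contamination

variable {d : ℕ} {φ : E d → ℝ}

/-! The estimator is controlled in `L²` distance between mixtures, and an `L²` geometric inequality
turns this into control of the weight alone, without estimating `μ`.

Geometry. Write `a`, `μ` for the estimate and `b`, `ν` for the truth. In Fourier terms the
difference of the mixtures has multiplier `P = a e^{-iμξ} - b e^{-iνξ} - (a - b)`. If `P` vanished,
taking moduli of `a e^{-iμξ} = b e^{-iνξ} + (a - b)` would give `2 b (a - b) (1 - cos(νξ)) = 0`,
from which `μ` has disappeared. `secondDiff_mul_sq_le` is the quantitative form, with physical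
translations in place of Fourier transforms: the distance controls `(a - b) b` times a second
difference of `φ` at `ν`. Second differences have squared norm at least `c ‖ν‖ ^ 4` on bounded sets
(`exists_mul_norm_pow_four_le_secondDiff`), so `‖ν‖ ^ 4 * min |a - b| b ^ 2` is at most a constant
times the squared distance.

Statistics. `φ` is bounded, so Bernstein's inequality and a union bound over the polynomially large
grid give squared distance `O(log n / n)` outside an event of probability `O(1 / n)`
(`exists_measureReal_sqDist_le`).

Conclusion. The lower bound on the true weight makes `‖ν‖ ^ 4 * b ^ 2` at least `ℓ_n ^ 2 / n`, which
for large `n` exceeds the bound obtained on the good event. The minimum is therefore `|a - b|`. The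
bad event and the finitely many small `n` are absorbed by the boundedness of the loss. -/

theorem memLp_translate (h : MemLp φ 2 volume) (μ : E d) :
    MemLp (fun x => φ (x - μ)) 2 volume :=
  h.comp_measurePreserving (measurePreserving_sub_right volume μ)

theorem memLp_translate_add (h : MemLp φ 2 volume) (μ : E d) :
    MemLp (fun x => φ (x + μ)) 2 volume :=
  h.comp_measurePreserving (measurePreserving_add_right volume μ)

theorem memLp_mixture (h : MemLp φ 2 volume) (a : ℝ) (μ : E d) :
    MemLp (mixture φ a μ) 2 volume :=
  (h.const_mul _).add ((memLp_translate h μ).const_mul _)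

theorem integral_le_add_add {p f g k : E d → ℝ} (hp : Integrable p volume)
    (hf : Integrable f volume) (hg : Integrable g volume) (hk : Integrable k volume)
    (h : ∀ x, p x ≤ f x + g x + k x) :
    ∫ x, p x ≤ (∫ x, f x) + (∫ x, g x) + ∫ x, k x := by
  rw [← integral_add' hf hg, ← integral_add' (hf.add hg) hk]
  exact integral_mono hp ((hf.add hg).add hk) h

theorem add_add_sq_le (x y z : ℝ) : (x + y + z) ^ 2 ≤ 3 * (x ^ 2 + y ^ 2 + z ^ 2) := by
  nlinarith [sq_nonneg (x - y), sq_nonneg (x - z), sq_nonneg (y - z)]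

/-! ### Second differences and the `L²` geometry of mixtures -/

/-- The squared `L²` norm of a symmetric second difference of `φ`. -/
noncomputable def secondDiff (φ : E d → ℝ) (μ : E d) : ℝ :=
  ∫ x, (φ (x - μ) - 2 * φ x + φ (x + μ)) ^ 2

theorem memLp_secondDiff (h : MemLp φ 2 volume) (μ : E d) :
    MemLp (fun x => φ (x - μ) - 2 * φ x + φ (x + μ)) 2 volume :=
  ((memLp_translate h μ).sub (h.const_mul 2)).add (memLp_translate_add h μ)

/-- The autocorrelation of `φ` is symmetric. -/
theorem integral_mul_translate_neg (φ : E d → ℝ) (u v : E d) :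
    ∫ x, φ (x + u) * φ (x + v) = ∫ x, φ (x - u) * φ (x - v) := by
  rw [← integral_sub_right_eq_self (fun x => φ (x + u) * φ (x + v)) (u + v)]
  refine integral_congr_ae (.of_forall fun x => ?_)
  have h1 : x - (u + v) + u = x - v := by abel
  have h2 : x - (u + v) + v = x - u := by abel
  simp only [h1, h2, mul_comm]

theorem integral_sq_combination {f g k : E d → ℝ} (hf : MemLp f 2 volume)
    (hg : MemLp g 2 volume) (hk : MemLp k 2 volume) (a b c : ℝ) :
    ∫ x, (a * f x + b * g x + c * k x) ^ 2 =
      a ^ 2 * (∫ x, f x * f x) + b ^ 2 * (∫ x, g x * g x) + c ^ 2 * (∫ x, k x * k x)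
        + 2 * a * b * (∫ x, f x * g x) + 2 * a * c * (∫ x, f x * k x)
        + 2 * b * c * ∫ x, g x * k x := by
  have hff : Integrable (fun x => a ^ 2 * (f x * f x)) volume := (hf.integrable_mul hf).const_mul _
  have hgg : Integrable (fun x => b ^ 2 * (g x * g x)) volume := (hg.integrable_mul hg).const_mul _
  have hkk : Integrable (fun x => c ^ 2 * (k x * k x)) volume := (hk.integrable_mul hk).const_mul _
  have hfg : Integrable (fun x => 2 * a * b * (f x * g x)) volume :=
    (hf.integrable_mul hg).const_mul _
  have hfk : Integrable (fun x => 2 * a * c * (f x * k x)) volume :=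
    (hf.integrable_mul hk).const_mul _
  have hgk : Integrable (fun x => 2 * b * c * (g x * k x)) volume :=
    (hg.integrable_mul hk).const_mul _
  simp only [← integral_const_mul]
  rw [← integral_add' hff hgg, ← integral_add' (hff.add hgg) hkk,
    ← integral_add' ((hff.add hgg).add hkk) hfg,
    ← integral_add' (((hff.add hgg).add hkk).add hfg) hfk,
    ← integral_add' ((((hff.add hgg).add hkk).add hfg).add hfk) hgk]
  refine integral_congr_ae (.of_forall fun x => ?_)
  simp only [Pi.add_apply]
  ring

/-- Expanding the square leaves only inner products of translates, and the autocorrelation is even.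
In Fourier terms, real coefficients make the two multipliers complex conjugates. -/
theorem integral_sq_neg_combination (h : MemLp φ 2 volume) (a b c : ℝ) (u v : E d) :
    ∫ x, (a * φ (x + u) + b * φ (x + v) + c * φ x) ^ 2 =
      ∫ x, (a * φ (x - u) + b * φ (x - v) + c * φ x) ^ 2 := by
  rw [integral_sq_combination (memLp_translate_add h u) (memLp_translate_add h v) h,
    integral_sq_combination (memLp_translate h u) (memLp_translate h v) h]
  have h1 := integral_mul_translate_neg φ u u
  have h2 := integral_mul_translate_neg φ v v
  have h3 := integral_mul_translate_neg φ u v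
  have h4 := integral_mul_translate_neg φ u 0
  have h5 := integral_mul_translate_neg φ v 0
  simp only [add_zero, sub_zero] at h4 h5
  rw [h1, h2, h3, h4, h5]

/-- Let `p` be the difference of the mixtures and `q` the same combination with reversed shifts,
which has the same norm. In `a p(· + μ) + (a - b) q + b q(· - ν)` every translate involving `μ`
cancels, leaving `-(a - b) b` times the second difference at `ν`. Translation invariance then gives
three terms of equal norm. -/
theorem secondDiff_mul_sq_le (h : MemLp φ 2 volume) (a b : ℝ) (μ ν : E d) :
    ((a - b) * b) ^ 2 * secondDiff φ ν ≤
      3 * (a ^ 2 + (a - b) ^ 2 + b ^ 2) *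
        ∫ x, (mixture φ a μ x - mixture φ b ν x) ^ 2 := by
  set p : E d → ℝ := fun x => a * φ (x - μ) + (-b) * φ (x - ν) + (b - a) * φ x with hp
  set q : E d → ℝ := fun x => a * φ (x + μ) + (-b) * φ (x + ν) + (b - a) * φ x with hq
  have hpL : MemLp p 2 volume := (((memLp_translate h μ).const_mul a).add
    ((memLp_translate h ν).const_mul (-b))).add (h.const_mul (b - a))
  have hqL : MemLp q 2 volume := (((memLp_translate_add h μ).const_mul a).add
    ((memLp_translate_add h ν).const_mul (-b))).add (h.const_mul (b - a))
  have hpq : ∫ x, q x ^ 2 = ∫ x, p x ^ 2 := integral_sq_neg_combination h a (-b) (b - a) μ ν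
  have hmix : (∫ x, (mixture φ a μ x - mixture φ b ν x) ^ 2) = ∫ x, p x ^ 2 := by
    refine integral_congr_ae (.of_forall fun x => ?_)
    simp only [mixture, hp]
    ring
  have e1 : ∫ x, p (x + μ) ^ 2 = ∫ x, p x ^ 2 :=
    integral_add_right_eq_self (fun x => p x ^ 2) μ
  have e2 : ∫ x, q (x - ν) ^ 2 = ∫ x, p x ^ 2 :=
    (integral_sub_right_eq_self (fun x => q x ^ 2) ν).trans hpq
  have i1 := (memLp_translate_add hpL μ).integrable_sq.const_mul (3 * a ^ 2)
  have i2 := hqL.integrable_sq.const_mul (3 * (a - b) ^ 2)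
  have i3 := (memLp_translate hqL ν).integrable_sq.const_mul (3 * b ^ 2)
  have key := integral_le_add_add
    ((memLp_secondDiff h ν).integrable_sq.const_mul (((a - b) * b) ^ 2)) i1 i2 i3 fun x => by
    have hid : -((a - b) * b * (φ (x - ν) - 2 * φ x + φ (x + ν))) =
        a * p (x + μ) + (a - b) * q x + b * q (x - ν) := by
      have h1 : x + μ - μ = x := by abel
      have h2 : x - ν + ν = x := by abel
      have h3 : x - ν + μ = x + μ - ν := by abel
      simp only [hp, hq, h1, h2, h3]
      ring
    calc ((a - b) * b) ^ 2 * (φ (x - ν) - 2 * φ x + φ (x + ν)) ^ 2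
        = (-((a - b) * b * (φ (x - ν) - 2 * φ x + φ (x + ν)))) ^ 2 := by ring
      _ = (a * p (x + μ) + (a - b) * q x + b * q (x - ν)) ^ 2 := by rw [hid]
      _ ≤ _ := add_add_sq_le _ _ _
      _ = _ := by ring
  rw [integral_const_mul, integral_const_mul, integral_const_mul, integral_const_mul, e1, e2,
    hpq] at key
  rw [secondDiff, hmix]
  linarith

theorem integral_sq_sub_nonneg (f g : E d → ℝ) : 0 ≤ ∫ x, (f x - g x) ^ 2 :=
  integral_nonneg fun _ => sq_nonneg _

theorem secondDiff_nonneg (φ : E d → ℝ) (ν : E d) : 0 ≤ secondDiff φ ν :=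
  integral_nonneg fun _ => sq_nonneg _

/-- Two mixtures that are close in `L²` have close weights, or the second weight is small. -/
theorem min_sq_mul_secondDiff_le (h : MemLp φ 2 volume) {a b : ℝ} (ha : 0 ≤ a) (hb : 0 < b)
    (μ ν : E d) :
    min |a - b| b ^ 2 * secondDiff φ ν ≤
      18 * ∫ x, (mixture φ a μ x - mixture φ b ν x) ^ 2 := by
  have key := secondDiff_mul_sq_le h a b μ ν
  have hD := integral_sq_sub_nonneg (mixture φ a μ) (mixture φ b ν)
  set D := ∫ x, (mixture φ a μ x - mixture φ b ν x) ^ 2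
  have hF := secondDiff_nonneg φ ν
  rcases le_or_gt |a - b| b with hc | hc
  · rw [min_eq_left hc, sq_abs]
    have h1 : a ^ 2 + (a - b) ^ 2 + b ^ 2 ≤ 6 * b ^ 2 := by
      obtain ⟨h1, h2⟩ := abs_le.1 hc
      nlinarith
    have h2 : b ^ 2 * ((a - b) ^ 2 * secondDiff φ ν) ≤ b ^ 2 * (18 * D) := by
      nlinarith [mul_le_mul_of_nonneg_right h1 hD]
    exact le_of_mul_le_mul_left h2 (by positivity)
  · rw [min_eq_right hc.le]
    -- Since `0 ≤ a`, the alternative `b < b - a` is impossible: the weight can only be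
    -- overestimated here.
    have hab : b ≤ a - b := by
      rcases le_total 0 (a - b) with h0 | h0
      · rw [abs_of_nonneg h0] at hc
        exact hc.le
      · rw [abs_of_nonpos h0] at hc
        linarith
    have h1 : a ^ 2 + (a - b) ^ 2 + b ^ 2 ≤ 6 * (a - b) ^ 2 := by nlinarith
    have h2 : (a - b) ^ 2 * (b ^ 2 * secondDiff φ ν) ≤ (a - b) ^ 2 * (18 * D) := by
      nlinarith [mul_le_mul_of_nonneg_right h1 hD]
    exact le_of_mul_le_mul_left h2 (by nlinarith)

/-- The second difference at `2ν` is the one at `ν` averaged with weights `1, 2, 1` over translates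
by `ν, 0, -ν`; the constant is `(1 + 2 + 1) ^ 2`. -/
theorem secondDiff_two_smul_le (h : MemLp φ 2 volume) (ν : E d) :
    secondDiff φ ((2 : ℝ) • ν) ≤ 16 * secondDiff φ ν := by
  set p : E d → ℝ := fun x => φ (x - ν) - 2 * φ x + φ (x + ν) with hp
  have hpL : MemLp p 2 volume := memLp_secondDiff h ν
  have e1 : ∫ x, p (x - ν) ^ 2 = secondDiff φ ν :=
    integral_sub_right_eq_self (fun x => p x ^ 2) ν
  have e2 : ∫ x, p (x + ν) ^ 2 = secondDiff φ ν :=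
    integral_add_right_eq_self (fun x => p x ^ 2) ν
  have e3 : ∫ x, p x ^ 2 = secondDiff φ ν := rfl
  have i1 := (memLp_translate hpL ν).integrable_sq.const_mul 4
  have i2 := hpL.integrable_sq.const_mul 8
  have i3 := (memLp_translate_add hpL ν).integrable_sq.const_mul 4
  have key := integral_le_add_add
    (memLp_secondDiff h ((2 : ℝ) • ν)).integrable_sq i1 i2 i3 fun x => by
    have hid : φ (x - (2 : ℝ) • ν) - 2 * φ x + φ (x + (2 : ℝ) • ν) =
        p (x - ν) + 2 * p x + p (x + ν) := by
      have h1 : x + ν - ν = x := by abel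
      have h2 : x - ν + ν = x := by abel
      have h3 : x - (2 : ℝ) • ν = x - ν - ν := by rw [two_smul]; abel
      have h4 : x + (2 : ℝ) • ν = x + ν + ν := by rw [two_smul]; abel
      simp only [hp, h1, h2, h3, h4]
      ring
    rw [hid]
    nlinarith [sq_nonneg (p (x - ν) - p x), sq_nonneg (p (x + ν) - p x),
      sq_nonneg (p (x - ν) - p (x + ν))]
  rw [integral_const_mul, integral_const_mul, integral_const_mul, e1, e2, e3] at key
  rw [secondDiff]
  linarith

theorem secondDiff_two_pow_smul_le (h : MemLp φ 2 volume) (ν : E d) (k : ℕ) :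
    secondDiff φ ((2 : ℝ) ^ k • ν) ≤ 16 ^ k * secondDiff φ ν := by
  induction k with
  | zero => simp
  | succ k ih =>
    rw [pow_succ', mul_smul, pow_succ']
    linarith [secondDiff_two_smul_le h ((2 : ℝ) ^ k • ν)]

theorem exists_integral_sq_tail_le (h : MemLp φ 2 volume) (hpos : 0 < ∫ x, φ x ^ 2) :
    ∃ r : ℝ, 0 < r ∧
      ∫ x, (Metric.ball (0 : E d) r)ᶜ.indicator (fun x => φ x ^ 2) x ≤ (∫ x, φ x ^ 2) / 10 := by
  have ht := tendsto_setIntegral_of_monotone (μ := (volume : Measure (E d)))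
    (s := fun n : ℕ => Metric.ball (0 : E d) n) (f := fun x => φ x ^ 2)
    (fun n => Metric.isOpen_ball.measurableSet)
    (fun m n hmn => Metric.ball_subset_ball (by exact_mod_cast hmn))
    h.integrable_sq.integrableOn
  rw [Metric.iUnion_ball_nat, setIntegral_univ] at ht
  obtain ⟨n, hn, hn1⟩ := ((ht.eventually (lt_mem_nhds
    (show 9 / 10 * (∫ x, φ x ^ 2) < ∫ x, φ x ^ 2 by linarith))).and
      (eventually_ge_atTop 1)).exists
  refine ⟨n, by exact_mod_cast hn1, ?_⟩
  rw [integral_indicator Metric.isOpen_ball.measurableSet.compl]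
  have := integral_add_compl (μ := (volume : Measure (E d)))
    (s := Metric.ball (0 : E d) n) Metric.isOpen_ball.measurableSet h.integrable_sq
  linarith

theorem exists_forall_le_secondDiff (h : MemLp φ 2 volume) (hpos : 0 < ∫ x, φ x ^ 2) :
    ∃ r : ℝ, 0 < r ∧ ∀ ν : E d, r ≤ ‖ν‖ → ∫ x, φ x ^ 2 ≤ secondDiff φ ν := by
  obtain ⟨r, hr, hw⟩ := exists_integral_sq_tail_le h hpos
  refine ⟨2 * r, by positivity, fun ν hν => ?_⟩
  set w := (Metric.ball (0 : E d) r)ᶜ.indicator (fun x => φ x ^ 2) with hwdef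
  have hwi : Integrable w volume :=
    h.integrable_sq.indicator Metric.isOpen_ball.measurableSet.compl
  have hw0 : ∀ x, 0 ≤ w x := fun x => Set.indicator_nonneg (fun _ _ => sq_nonneg _) x
  have hwx : ∀ x, r ≤ ‖x‖ → w x = φ x ^ 2 := fun x hx =>
    Set.indicator_of_mem (by simpa using hx) _
  have i0 := (memLp_secondDiff h ν).integrable_sq.const_mul 3
  have i1 := hwi.comp_sub_right ν
  have i2 := hwi.comp_add_right ν
  have i3 : Integrable (fun x => 3 * (w (x - ν) + w (x + ν))) volume := (i1.add i2).const_mul 3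
  have e1 : ∫ x, w (x - ν) = ∫ x, w x := integral_sub_right_eq_self w ν
  have e2 : ∫ x, w (x + ν) = ∫ x, w x := integral_add_right_eq_self w ν
  -- For `‖ν‖ ≥ 2r`, a point `x` inside the ball has both `x ± ν` outside, so `2 φ x` is the second
  -- difference up to tail values. Integration gives `4 Φ ≤ 3 F + 10 ∫ w`, with `Φ = ∫ φ ^ 2` and
  -- `F` the second difference; this is why the tail was taken below `Φ / 10`.
  have key := integral_le_add_add (h.integrable_sq.const_mul 4) i0 i3 (hwi.const_mul 4) fun x => by
    rcases le_or_gt r ‖x‖ with hx | hx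
    · rw [hwx x hx]
      nlinarith [hw0 (x - ν), hw0 (x + ν), sq_nonneg (φ (x - ν) - 2 * φ x + φ (x + ν))]
    · have h1 : r ≤ ‖x - ν‖ := by
        have := norm_sub_norm_le ν x
        rw [norm_sub_rev] at this
        linarith
      have h2 : r ≤ ‖x + ν‖ := by
        have := norm_sub_norm_le ν (-x)
        rw [norm_neg, sub_neg_eq_add, add_comm ν x] at this
        linarith
      rw [hwx _ h1, hwx _ h2]
      nlinarith [hw0 x, sq_nonneg ((φ (x - ν) - 2 * φ x + φ (x + ν)) + φ (x - ν)),
        sq_nonneg ((φ (x - ν) - 2 * φ x + φ (x + ν)) + φ (x + ν)),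
        sq_nonneg (φ (x - ν) - φ (x + ν))]
  rw [integral_const_mul, integral_const_mul, integral_const_mul, integral_const_mul,
    integral_add i1 i2, e1, e2] at key
  rw [secondDiff]
  linarith

/-- Second differences of a nonzero square integrable function are at least quadratic. -/
theorem exists_mul_norm_pow_four_le_secondDiff (h : MemLp φ 2 volume)
    (hpos : 0 < ∫ x, φ x ^ 2) (R : ℝ) :
    ∃ c : ℝ, 0 < c ∧ ∀ ν : E d, ‖ν‖ ≤ R → c * ‖ν‖ ^ 4 ≤ secondDiff φ ν := by
  obtain ⟨r, hr, hF⟩ := exists_forall_le_secondDiff h hpos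
  set s := max r R with hs
  have hs0 : 0 < s := hr.trans_le (le_max_left _ _)
  refine ⟨(∫ x, φ x ^ 2) / (2 * s) ^ 4, by positivity, fun ν hν => ?_⟩
  rcases eq_or_ne ν 0 with rfl | hν0
  · simpa using secondDiff_nonneg φ (0 : E d)
  have hn : 0 < ‖ν‖ := norm_pos_iff.2 hν0
  -- Double `ν` until its norm lies in `(s, 2s]`: there the large-shift bound applies, and each
  -- doubling has cost a factor `16 = 2 ^ 4`, whence the fourth power.
  obtain ⟨k, hk1, hk2⟩ := exists_nat_pow_near
    ((one_le_div hn).2 (hν.trans (le_max_right r R))) (one_lt_two (α := ℝ))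
  rw [le_div_iff₀ hn] at hk1
  rw [div_lt_iff₀ hn] at hk2
  have h1 : ‖(2 : ℝ) ^ (k + 1) • ν‖ = 2 ^ (k + 1) * ‖ν‖ := by
    rw [norm_smul, Real.norm_of_nonneg (by positivity)]
  have h2 := (hF ((2 : ℝ) ^ (k + 1) • ν)
    (by rw [h1]; exact (le_max_left r R).trans hk2.le)).trans
    (secondDiff_two_pow_smul_le h ν (k + 1))
  have h3 : (16 : ℝ) ^ (k + 1) * ‖ν‖ ^ 4 ≤ (2 * s) ^ 4 := by
    have h4 : (2 : ℝ) ^ (k + 1) * ‖ν‖ ≤ 2 * s := by rw [pow_succ]; linarith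
    calc (16 : ℝ) ^ (k + 1) * ‖ν‖ ^ 4 = (2 ^ (k + 1) * ‖ν‖) ^ 4 := by
          rw [mul_pow, ← pow_mul, mul_comm (k + 1) 4, pow_mul]; norm_num
      _ ≤ _ := pow_le_pow_left₀ (by positivity) h4 4
  rw [div_mul_eq_mul_div, div_le_iff₀ (by positivity)]
  calc (∫ x, φ x ^ 2) * ‖ν‖ ^ 4 ≤ 16 ^ (k + 1) * secondDiff φ ν * ‖ν‖ ^ 4 := by gcongr
    _ = secondDiff φ ν * (16 ^ (k + 1) * ‖ν‖ ^ 4) := by ring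
    _ ≤ _ := mul_le_mul_of_nonneg_left h3 (secondDiff_nonneg φ ν)

theorem IsProbDensity.integral_sq_pos (hφ : IsProbDensity φ) (h : MemLp φ 2 volume) :
    0 < ∫ x, φ x ^ 2 := by
  refine (integral_nonneg fun _ => sq_nonneg _).lt_of_ne fun h0 => ?_
  have h1 := (integral_eq_zero_iff_of_nonneg (fun _ => sq_nonneg _) h.integrable_sq).1 h0.symm
  have h2 : φ =ᵐ[volume] 0 := h1.mono fun x hx => by simpa using hx
  have := hφ.integral_eq_one
  rw [integral_congr_ae h2] at this
  simp at this

/-! ### Boundedness of the density -/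

theorem mem_cube_of_norm_le {M : ℝ} {μ : E d} (h : ‖μ‖ ≤ M) : μ ∈ cube d M :=
  fun j => (PiLp.norm_apply_le μ j).trans h

theorem norm_sq_le_of_forall_abs_le {μ : E d} {r : ℝ} (h : ∀ j, |μ j| ≤ r) :
    ‖μ‖ ^ 2 ≤ d * r ^ 2 := by
  rw [EuclideanSpace.norm_sq_eq]
  calc ∑ i, ‖μ i‖ ^ 2 ≤ ∑ _i : Fin d, r ^ 2 :=
        Finset.sum_le_sum fun i _ => pow_le_pow_left₀ (norm_nonneg _) (h i) 2
    _ = _ := by simp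

/-- A density satisfying the Lipschitz assumption is bounded. -/
theorem IsProbDensity.exists_bound {M : ℝ} (hM : 0 < M) (hφ : IsProbDensity φ)
    (hLip : LipAssumption M φ) : ∃ B : ℝ, 0 < B ∧ ∀ x, φ x ≤ B := by
  obtain ⟨g, hg, hlip, -⟩ := hLip
  set V := volume.real (Metric.ball (0 : E d) M) with hV
  have hV0 : 0 < V := ENNReal.toReal_pos (Metric.measure_ball_pos volume _ hM).ne'
    measure_ball_lt_top.ne
  have hG0 : 0 ≤ ∫ x, g x ^ 2 := integral_nonneg fun _ => sq_nonneg _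
  refine ⟨(1 + M * (V + ∫ x, g x ^ 2)) / V, by positivity, fun y => ?_⟩
  rw [le_div_iff₀ hV0]
  have hVy : volume.real (Metric.ball y M) = V := by
    simp only [hV, Measure.real, Measure.addHaar_ball_center volume y M]
  have hfin : volume (Metric.ball y M) ≠ ⊤ := measure_ball_lt_top.ne
  have i0 : IntegrableOn (fun _ => φ y) (Metric.ball y M) volume := integrableOn_const hfin
  have i1 : IntegrableOn φ (Metric.ball y M) volume := hφ.integrable.integrableOn
  have ic : IntegrableOn (fun _ => (1 : ℝ)) (Metric.ball y M) volume := integrableOn_const hfin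
  have i2 : IntegrableOn (fun x => M * (1 + g x ^ 2)) (Metric.ball y M) volume :=
    (ic.add hg.integrable_sq.integrableOn).const_mul M
  have key : ∫ _x in Metric.ball y M, φ y ≤ ∫ x in Metric.ball y M, φ x + M * (1 + g x ^ 2) := by
    refine setIntegral_mono_on i0 (i1.add i2) Metric.isOpen_ball.measurableSet fun x hx => ?_
    have hxy : ‖x - y‖ ≤ M := by
      rw [← dist_eq_norm]; exact (Metric.mem_ball.1 hx).le
    -- The shift `x - y` carries `x` to `y`, so `φ y ≤ φ x + M (1 + g x ^ 2)` on the ball; averaging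
    -- over `x` bounds `φ y` uniformly.
    have h1 := hlip x (x - y) (mem_cube_of_norm_le hxy)
    rw [sub_sub_cancel] at h1
    have h2 : ‖x - y‖ * g x ≤ M * (1 + g x ^ 2) :=
      (mul_le_mul_of_nonneg_left (by nlinarith [sq_nonneg (g x - 1)]) (norm_nonneg _)).trans
        (mul_le_mul_of_nonneg_right hxy (by positivity))
    linarith [(abs_le.1 h1).1]
  rw [integral_add i1 i2, integral_const_mul,
    integral_add ic hg.integrable_sq.integrableOn] at key
  simp only [setIntegral_const, hVy, smul_eq_mul, mul_one] at key
  have h1 : ∫ x in Metric.ball y M, φ x ≤ 1 :=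
    hφ.integral_eq_one ▸ setIntegral_le_integral hφ.integrable (.of_forall hφ.nonneg)
  have h2 : ∫ x in Metric.ball y M, g x ^ 2 ≤ ∫ x, g x ^ 2 :=
    setIntegral_le_integral hg.integrable_sq (.of_forall fun _ => sq_nonneg _)
  have h3 := mul_le_mul_of_nonneg_left h2 hM.le
  linarith

/-! ### Bernstein's inequality for i.i.d. sums -/

section Chernoff

variable {Ω : Type*} [MeasurableSpace Ω] {Q : Measure Ω} [IsProbabilityMeasure Q]

theorem integrable_of_forall_abs_le {h : Ω → ℝ} (hm : Measurable h) {c : ℝ}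
    (hb : ∀ x, |h x| ≤ c) : Integrable h Q :=
  .of_bound hm.aestronglyMeasurable c (.of_forall hb)

theorem integral_exp_mul_le {h : Ω → ℝ} (hm : Measurable h) {c u : ℝ} (hc : ∀ x, |h x| ≤ c)
    (hu : 0 ≤ u) (huc : u * c ≤ 1) :
    ∫ x, Real.exp (u * h x) ∂Q ≤ Real.exp (u * ∫ x, h x ∂Q + u ^ 2 * ∫ x, h x ^ 2 ∂Q) := by
  have huh : ∀ x, |u * h x| ≤ 1 := fun x => by
    rw [abs_mul, abs_of_nonneg hu]
    exact (mul_le_mul_of_nonneg_left (hc x) hu).trans huc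
  have i1 : Integrable (fun x => u * h x) Q := (integrable_of_forall_abs_le hm hc).const_mul u
  have i2 : Integrable (fun x => u ^ 2 * h x ^ 2) Q :=
    (integrable_of_forall_abs_le (hm.pow_const 2) (c := c ^ 2) fun x => by
      rw [abs_pow]; exact pow_le_pow_left₀ (abs_nonneg _) (hc x) 2).const_mul _
  have ie : Integrable (fun x => Real.exp (u * h x)) Q :=
    integrable_of_forall_abs_le (hm.const_mul u).exp (c := Real.exp 1) fun x => by
      rw [abs_of_pos (Real.exp_pos _)]
      exact Real.exp_le_exp.2 (abs_le.1 (huh x)).2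
  calc ∫ x, Real.exp (u * h x) ∂Q ≤ ∫ x, ((fun _ => (1 : ℝ)) + (fun x => u * h x) +
        (fun x => u ^ 2 * h x ^ 2) : Ω → ℝ) x ∂Q := by
        refine integral_mono ie (((integrable_const 1).add i1).add i2) fun x => ?_
        have := (abs_le.1 (Real.abs_exp_sub_one_sub_id_le (huh x))).2
        simp only [Pi.add_apply]
        linarith [mul_pow u (h x) 2]
    _ = 1 + (u * ∫ x, h x ∂Q + u ^ 2 * ∫ x, h x ^ 2 ∂Q) := by
        rw [integral_add' ((integrable_const 1).add i1) i2, integral_add' (integrable_const 1) i1,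
          integral_const_mul, integral_const_mul]
        simp [add_assoc]
    _ ≤ _ := by linarith [Real.add_one_le_exp (u * ∫ x, h x ∂Q + u ^ 2 * ∫ x, h x ^ 2 ∂Q)]

/-- Bernstein's inequality in Chernoff form for an i.i.d. sample. -/
theorem measureReal_pi_le_sum_le {h : Ω → ℝ} (hm : Measurable h) {c u : ℝ}
    (hc : ∀ x, |h x| ≤ c) (hu : 0 ≤ u) (huc : u * c ≤ 1) (n : ℕ) (t : ℝ) :
    (Measure.pi fun _ : Fin n => Q).real {X | t ≤ ∑ i, h (X i)} ≤
      Real.exp (-u * t + n * (u * ∫ x, h x ∂Q + u ^ 2 * ∫ x, h x ^ 2 ∂Q)) := by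
  have hS : Measurable fun X : Fin n → Ω => ∑ i, h (X i) :=
    Finset.measurable_sum _ fun i _ => hm.comp (measurable_pi_apply i)
  have hSb : ∀ X : Fin n → Ω, |∑ i, h (X i)| ≤ n * c := fun X =>
    (Finset.abs_sum_le_sum_abs _ _).trans <|
      (Finset.sum_le_sum fun i _ => hc (X i)).trans (by simp)
  have ie : Integrable (fun X : Fin n → Ω => Real.exp (u * ∑ i, h (X i)))
      (Measure.pi fun _ => Q) :=
    integrable_of_forall_abs_le (hS.const_mul u).exp (c := Real.exp (u * (n * c))) fun X => by
      rw [abs_of_pos (Real.exp_pos _)]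
      exact Real.exp_le_exp.2 (mul_le_mul_of_nonneg_left (abs_le.1 (hSb X)).2 hu)
  refine (ProbabilityTheory.measure_ge_le_exp_mul_mgf t hu ie).trans ?_
  rw [Real.exp_add, ProbabilityTheory.mgf]
  refine mul_le_mul_of_nonneg_left ?_ (Real.exp_pos _).le
  have hprod : ∫ X : Fin n → Ω, Real.exp (u * ∑ i, h (X i)) ∂(Measure.pi fun _ => Q) =
      (∫ x, Real.exp (u * h x) ∂Q) ^ n := by
    simp only [Finset.mul_sum, Real.exp_sum]
    rw [integral_fintype_prod_eq_prod (fun _ : Fin n => fun x => Real.exp (u * h x))]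
    simp
  rw [hprod, Real.exp_nat_mul]
  exact pow_le_pow_left₀ (integral_nonneg fun _ => (Real.exp_pos _).le)
    (integral_exp_mul_le hm hc hu huc) n

end Chernoff

/-! ### Deviations of the empirical contrast and the oracle inequality -/

theorem IsProbDensity.mixture (hφ : IsProbDensity φ) {a : ℝ} (h0 : 0 ≤ a) (h1 : a ≤ 1)
    (μ : E d) : IsProbDensity (mixture φ a μ) where
  nonneg x := add_nonneg (mul_nonneg (sub_nonneg.2 h1) (hφ.nonneg _))
    (mul_nonneg h0 (hφ.nonneg _))
  integrable := (hφ.integrable.const_mul _).add ((hφ.integrable.comp_sub_right μ).const_mul _)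
  integral_eq_one := by
    have := integral_add (hφ.integrable.const_mul (1 - a))
      ((hφ.integrable.comp_sub_right μ).const_mul a)
    rw [integral_const_mul, integral_const_mul, integral_sub_right_eq_self φ μ,
      hφ.integral_eq_one] at this
    refine Eq.trans this (by ring)

theorem mixture_le {B : ℝ} (hB : ∀ x, φ x ≤ B) {a : ℝ} (h0 : 0 ≤ a) (h1 : a ≤ 1)
    (μ x : E d) : mixture φ a μ x ≤ B := by
  have e1 := mul_le_mul_of_nonneg_left (hB x) (sub_nonneg.2 h1)
  have e2 := mul_le_mul_of_nonneg_left (hB (x - μ)) h0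
  rw [Contamination.mixture]
  linarith

theorem measurable_mixture (hφ : Measurable φ) (a : ℝ) (μ : E d) :
    Measurable (mixture φ a μ) :=
  (hφ.const_mul _).add ((hφ.comp (measurable_id.sub_const μ)).const_mul _)

/-- The probability measure with density `f`. -/
noncomputable def densityMeasure (f : E d → ℝ) : Measure (E d) :=
  volume.withDensity fun x => ENNReal.ofReal (f x)

theorem IsProbDensity.isProbabilityMeasure {f : E d → ℝ} (hf : IsProbDensity f) :
    IsProbabilityMeasure (densityMeasure f) where
  measure_univ := by
    rw [densityMeasure, withDensity_apply _ MeasurableSet.univ, setLIntegral_univ,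
      ← ofReal_integral_eq_lintegral_ofReal hf.integrable (.of_forall hf.nonneg),
      hf.integral_eq_one, ENNReal.ofReal_one]

theorem integral_densityMeasure {f : E d → ℝ} (hm : Measurable f) (hf : ∀ x, 0 ≤ f x)
    (h : E d → ℝ) : ∫ x, h x ∂(densityMeasure f) = ∫ x, f x * h x := by
  rw [densityMeasure, integral_withDensity_eq_integral_toReal_smul hm.ennreal_ofReal
    (.of_forall fun _ => ENNReal.ofReal_lt_top)]
  refine integral_congr_ae (.of_forall fun x => ?_)
  simp only [ENNReal.toReal_ofReal (hf x), smul_eq_mul]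

/-- Deviations of an empirical sum, with the variance traded against the squared `L²` norm. -/
theorem measureReal_deviation_le {f : E d → ℝ} (hf : IsProbDensity f) (hfm : Measurable f)
    {B : ℝ} (hB0 : 0 < B) (hB : ∀ x, f x ≤ B) {h : E d → ℝ} (hm : Measurable h)
    (hL : MemLp h 2 volume) (hb : ∀ x, |h x| ≤ B) (n : ℕ) (t : ℝ) :
    (Measure.pi fun _ : Fin n => densityMeasure f).real
      {X | n * (∫ x, f x * h x) + n * (∫ x, h x ^ 2) / 8 + t ≤ ∑ i, h (X i)} ≤
      Real.exp (-(1 / (8 * (B + 1))) * t) := by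
  have := hf.isProbabilityMeasure
  -- This choice makes `u * B ≤ 1 / 8`: the Chernoff condition holds, and the variance, at most `B ∫
  -- h ^ 2`, is absorbed by the term `n (∫ h ^ 2) / 8` of the threshold.
  set u := 1 / (8 * (B + 1)) with hu
  have hu0 : 0 < u := by positivity
  have huB : u * B ≤ 1 / 8 := by
    rw [hu, div_mul_eq_mul_div, div_le_iff₀ (by positivity)]
    linarith
  refine (measureReal_pi_le_sum_le hm hb hu0.le (by linarith) n _).trans (Real.exp_le_exp.2 ?_)
  rw [integral_densityMeasure hfm hf.nonneg, integral_densityMeasure hfm hf.nonneg]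
  have hD : 0 ≤ ∫ x, h x ^ 2 := integral_nonneg fun _ => sq_nonneg _
  have hv : ∫ x, f x * h x ^ 2 ≤ B * ∫ x, h x ^ 2 := by
    rw [← integral_const_mul]
    refine integral_mono_of_nonneg (.of_forall fun x => mul_nonneg (hf.nonneg x) (sq_nonneg _))
      (hL.integrable_sq.const_mul B) (.of_forall fun x => ?_)
    exact mul_le_mul_of_nonneg_right (hB x) (sq_nonneg _)
  have h1 : u ^ 2 * ∫ x, f x * h x ^ 2 ≤ u * (1 / 8 * ∫ x, h x ^ 2) := by
    calc u ^ 2 * ∫ x, f x * h x ^ 2 ≤ u ^ 2 * (B * ∫ x, h x ^ 2) := by gcongr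
      _ = u * (u * B * ∫ x, h x ^ 2) := by ring
      _ ≤ _ := by gcongr
  have h2 := mul_le_mul_of_nonneg_left h1 (Nat.cast_nonneg (α := ℝ) n)
  linarith

/-- The squared `L²` distance between two mixtures. -/
noncomputable def sqDist (φ : E d → ℝ) (p θ : ℝ × E d) : ℝ :=
  ∫ x, (mixture φ p.1 p.2 x - mixture φ θ.1 θ.2 x) ^ 2

theorem memLp_mixture_sub (h : MemLp φ 2 volume) (p θ : ℝ × E d) :
    MemLp (fun x => mixture φ p.1 p.2 x - mixture φ θ.1 θ.2 x) 2 volume :=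
  (memLp_mixture h p.1 p.2).sub (memLp_mixture h θ.1 θ.2)

/-- Expanding `f_p ^ 2` around `f_θ` shows that the contrast difference is the squared distance
minus twice a centred empirical mean under `θ`. -/
theorem contrast_eq (h : MemLp φ 2 volume) {n : ℕ} (X : Fin n → E d) (p θ : ℝ × E d) :
    contrast φ X p = sqDist φ p θ
      + 2 * (∫ x, mixture φ θ.1 θ.2 x * (mixture φ p.1 p.2 x - mixture φ θ.1 θ.2 x))
      - 2 / n * ∑ i, (mixture φ p.1 p.2 (X i) - mixture φ θ.1 θ.2 (X i))
      + contrast φ X θ := by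
  have hs := memLp_mixture_sub h p θ
  have hθ := memLp_mixture h θ.1 θ.2
  have i2 : Integrable (fun x => 2 * (mixture φ θ.1 θ.2 x *
      (mixture φ p.1 p.2 x - mixture φ θ.1 θ.2 x))) volume := (hθ.integrable_mul hs).const_mul 2
  have e : ∫ x, mixture φ p.1 p.2 x ^ 2 = sqDist φ p θ
      + 2 * (∫ x, mixture φ θ.1 θ.2 x * (mixture φ p.1 p.2 x - mixture φ θ.1 θ.2 x))
      + ∫ x, mixture φ θ.1 θ.2 x ^ 2 := by
    rw [sqDist, ← integral_const_mul, ← integral_add' hs.integrable_sq i2,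
      ← integral_add' (hs.integrable_sq.add i2) hθ.integrable_sq]
    refine integral_congr_ae (.of_forall fun x => ?_)
    simp only [Pi.add_apply]
    ring
  rw [contrast, contrast, e, Finset.sum_sub_distrib]
  ring

/-- The sample points at which the empirical process at `p` deviates by more than `t`. -/
def deviationSet (φ : E d → ℝ) (θ p : ℝ × E d) (n : ℕ) (t : ℝ) : Set (Fin n → E d) :=
  {X | n * sqDist φ p θ / 8 + t ≤
    |∑ i, (mixture φ p.1 p.2 (X i) - mixture φ θ.1 θ.2 (X i)) -
      n * ∫ x, mixture φ θ.1 θ.2 x * (mixture φ p.1 p.2 x - mixture φ θ.1 θ.2 x)|}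

theorem measurableSet_deviationSet (hm : Measurable φ) (θ p : ℝ × E d) (n : ℕ) (t : ℝ) :
    MeasurableSet (deviationSet φ θ p n t) := by
  refine measurableSet_le measurable_const (Measurable.abs (Measurable.sub_const ?_ _))
  exact Finset.measurable_sum _ fun i _ =>
    ((measurable_mixture hm _ _).sub (measurable_mixture hm _ _)).comp (measurable_pi_apply i)

theorem measureReal_deviationSet_le (hφ : IsProbDensity φ) (hm : Measurable φ)
    (h : MemLp φ 2 volume) {B : ℝ} (hB0 : 0 < B) (hB : ∀ x, φ x ≤ B) {θ p : ℝ × E d}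
    (hθ0 : 0 ≤ θ.1) (hθ1 : θ.1 ≤ 1) (hp0 : 0 ≤ p.1) (hp1 : p.1 ≤ 1) (n : ℕ) (t : ℝ) :
    (sampleLaw φ θ.1 θ.2 n).real (deviationSet φ θ p n t) ≤
      2 * Real.exp (-(1 / (8 * (B + 1))) * t) := by
  have hf := hφ.mixture hθ0 hθ1 θ.2
  have hfm := measurable_mixture hm θ.1 θ.2
  have := hf.isProbabilityMeasure
  have hpn := (hφ.mixture hp0 hp1 p.2).nonneg
  have hfB := mixture_le hB hθ0 hθ1 θ.2
  have hpB := mixture_le hB hp0 hp1 p.2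
  have hdm := (measurable_mixture hm p.1 p.2).sub hfm
  have hdL := memLp_mixture_sub h p θ
  set k : E d → ℝ := fun x => mixture φ p.1 p.2 x - mixture φ θ.1 θ.2 x with hk
  have hkb : ∀ x, |k x| ≤ B := fun x => abs_le.2
    ⟨by simp only [hk]; linarith [hpn x, hfB x], by simp only [hk]; linarith [hpB x, hf.nonneg x]⟩
  have h1 := measureReal_deviation_le hf hfm hB0 hfB hdm hdL hkb n t
  have h2 := measureReal_deviation_le hf hfm hB0 hfB hdm.neg hdL.neg
    (fun x => by rw [Pi.neg_apply, abs_neg]; exact hkb x) n t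
  have hsub : deviationSet φ θ p n t ⊆
      {X | n * (∫ x, mixture φ θ.1 θ.2 x * k x) + n * (∫ x, k x ^ 2) / 8 + t ≤ ∑ i, k (X i)} ∪
      {X | n * (∫ x, mixture φ θ.1 θ.2 x * (-k) x) + n * (∫ x, (-k) x ^ 2) / 8 + t ≤
        ∑ i, (-k) (X i)} := by
    intro X hX
    have hX : n * (∫ x, k x ^ 2) / 8 + t ≤
      |∑ i, k (X i) - n * ∫ x, mixture φ θ.1 θ.2 x * k x| := hX
    rcases le_abs.1 hX with hX | hX
    · left
      simp only [Set.mem_ofPred_eq]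
      linarith
    · right
      simp only [Set.mem_ofPred_eq, Pi.neg_apply, mul_neg, neg_sq, integral_neg,
        Finset.sum_neg_distrib]
      linarith
  have : IsFiniteMeasure (sampleLaw φ θ.1 θ.2 n) :=
    inferInstanceAs (IsFiniteMeasure (Measure.pi fun _ => densityMeasure (mixture φ θ.1 θ.2)))
  refine (measureReal_mono hsub (measure_ne_top _ _)).trans ((measureReal_union_le _ _).trans ?_)
  rw [two_mul]
  exact add_le_add h1 h2

theorem sqDist_nonneg (φ : E d → ℝ) (p θ : ℝ × E d) : 0 ≤ sqDist φ p θ :=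
  integral_nonneg fun _ => sq_nonneg _

/-- Oracle inequality for a minimizer of the contrast outside the deviation sets. -/
theorem sqDist_le_of_notMem_deviationSet (h : MemLp φ 2 volume) {n : ℕ} (hn : 0 < n)
    {X : Fin n → E d} {p q θ : ℝ × E d} {t : ℝ} (hpq : contrast φ X p ≤ contrast φ X q)
    (hp : X ∉ deviationSet φ θ p n t) (hq : X ∉ deviationSet φ θ q n t) :
    sqDist φ p θ ≤ 2 * sqDist φ q θ + 6 * (t / n) := by
  have hn' : (0 : ℝ) < n := Nat.cast_pos.2 hn
  rw [contrast_eq h X p θ, contrast_eq h X q θ] at hpq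
  simp only [deviationSet, Set.mem_ofPred_eq, not_le] at hp hq
  have hp := (abs_lt.1 hp).2
  have hq := (abs_lt.1 hq).1
  have hq0 := sqDist_nonneg φ q θ
  have hp0 := sqDist_nonneg φ p θ
  set S := ∑ i, (mixture φ p.1 p.2 (X i) - mixture φ θ.1 θ.2 (X i))
  set S' := ∑ i, (mixture φ q.1 q.2 (X i) - mixture φ θ.1 θ.2 (X i))
  set m := ∫ x, mixture φ θ.1 θ.2 x * (mixture φ p.1 p.2 x - mixture φ θ.1 θ.2 x)
  set m' := ∫ x, mixture φ θ.1 θ.2 x * (mixture φ q.1 q.2 x - mixture φ θ.1 θ.2 x)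
  have e1 : S / n < m + sqDist φ p θ / 8 + t / n := by
    rw [div_lt_iff₀ hn']
    have : (m + sqDist φ p θ / 8 + t / n) * n = n * m + n * sqDist φ p θ / 8 + t := by
      field_simp
    linarith
  have e2 : m' - sqDist φ q θ / 8 - t / n < S' / n := by
    rw [lt_div_iff₀ hn']
    have : (m' - sqDist φ q θ / 8 - t / n) * n = n * m' - n * sqDist φ q θ / 8 - t := by
      field_simp
    linarith
  have e3 : 2 / (n : ℝ) * S = 2 * (S / n) := by ring
  have e4 : 2 / (n : ℝ) * S' = 2 * (S' / n) := by ring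
  rw [e3, e4] at hpq
  -- Each deviation enters twice, so `(3/4) D_p ≤ (5/4) D_q + 4 t / n`; the constants `2` and `6`
  -- are rounded up from `5/3` and `16/3`.
  linarith

theorem isProbabilityMeasure_sampleLaw (hφ : IsProbDensity φ) {θ : ℝ × E d} (h0 : 0 ≤ θ.1)
    (h1 : θ.1 ≤ 1) (n : ℕ) : IsProbabilityMeasure (sampleLaw φ θ.1 θ.2 n) := by
  have := (hφ.mixture h0 h1 θ.2).isProbabilityMeasure
  exact inferInstanceAs
    (IsProbabilityMeasure (Measure.pi fun _ => densityMeasure (mixture φ θ.1 θ.2)))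

/-! ### The grid: approximation, cardinality and bias -/

theorem exists_nat_div_near {s L x : ℝ} (hs : 0 < s) (hL : 1 ≤ L * s) (h0 : 0 ≤ x)
    (hx : x ≤ L) : ∃ k : ℕ, 1 ≤ k ∧ (k : ℝ) ≤ L * s ∧ |k / s - x| ≤ 1 / s := by
  have hxs : 0 ≤ x * s := by positivity
  have key : ∀ k : ℕ, |(k : ℝ) - x * s| ≤ 1 → |k / s - x| ≤ 1 / s := fun k hk => by
    rw [div_sub' hs.ne', abs_div, abs_of_pos hs, mul_comm s x]
    gcongr
  -- The grid omits `0`, so values below `1 / s` are rounded up to `1 / s` and all others down; `1 ≤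
  -- L * s` makes `k = 1` admissible.
  rcases le_or_gt 1 ⌊x * s⌋₊ with h | h
  · refine ⟨⌊x * s⌋₊, h, (Nat.floor_le hxs).trans (by gcongr), key _ ?_⟩
    rw [abs_le]
    constructor <;> linarith [Nat.floor_le hxs, Nat.lt_floor_add_one (x * s)]
  · have h1 : x * s < 1 := Nat.floor_eq_zero.1 (by omega)
    refine ⟨1, le_rfl, by simpa using hL, key _ ?_⟩
    rw [abs_le]
    push_cast
    constructor <;> linarith

/-- Every parameter is approximated by the grid at scale `1 / √n`. -/
theorem exists_mem_grid_near {M : ℝ} {n : ℕ} (hn : 1 ≤ n) (hMn : 1 ≤ M * √(n : ℝ))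
    {θ : ℝ × E d} (h0 : 0 ≤ θ.1) (h1 : θ.1 ≤ 1) (hθ : θ.2 ∈ cube d M) :
    ∃ q ∈ grid d M n, |q.1 - θ.1| ≤ 1 / √(n : ℝ) ∧ ∀ j, |q.2 j - θ.2 j| ≤ 1 / √(n : ℝ) := by
  have hs1 : 1 ≤ √(n : ℝ) := Real.one_le_sqrt.2 (by exact_mod_cast hn)
  have hs : 0 < √(n : ℝ) := by linarith
  obtain ⟨i, hi1, hi2, hi3⟩ := exists_nat_div_near (L := 1) hs (by linarith) h0 h1
  have hj : ∀ j, ∃ y : ℝ, (∃ k : ℕ, 1 ≤ k ∧ (k : ℝ) ≤ M * √(n : ℝ) ∧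
      (y = k / √(n : ℝ) ∨ y = -(k / √(n : ℝ)))) ∧ |y - θ.2 j| ≤ 1 / √(n : ℝ) := fun j => by
    obtain ⟨k, hk1, hk2, hk3⟩ := exists_nat_div_near hs hMn (abs_nonneg (θ.2 j)) (hθ j)
    rcases abs_choice (θ.2 j) with h | h
    · exact ⟨k / √(n : ℝ), ⟨k, hk1, hk2, .inl rfl⟩, by rwa [h] at hk3⟩
    · refine ⟨-(k / √(n : ℝ)), ⟨k, hk1, hk2, .inr rfl⟩, ?_⟩
      rw [h, sub_neg_eq_add] at hk3
      rwa [← neg_add', abs_neg]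
  choose y hy1 hy2 using hj
  exact ⟨(i / √(n : ℝ), WithLp.toLp 2 y), ⟨⟨i, hi1, by simpa using hi2, rfl⟩, hy1⟩, hi3, hy2⟩

theorem mem_grid_fst {M : ℝ} {n : ℕ} {p : ℝ × E d} (h : p ∈ grid d M n) :
    0 ≤ p.1 ∧ p.1 ≤ 1 := by
  obtain ⟨⟨i, -, hi, he⟩, -⟩ := h
  rw [he]
  exact ⟨by positivity, div_le_one_of_le₀ hi (Real.sqrt_nonneg _)⟩

/-- A finite set of parameters that contains the grid and has polynomially many elements. -/
theorem exists_finset_grid_subset (d : ℕ) (M : ℝ) :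
    ∃ C : ℝ, 0 < C ∧ ∀ n : ℕ, 1 ≤ n → ∃ G : Finset (ℝ × E d), ↑G = grid d M n ∧
      (G.card : ℝ) ≤ C * (n : ℝ) ^ (d + 1) := by
  classical
  set K := ⌈M⌉₊ + 1 with hK
  refine ⟨2 * (3 * K : ℝ) ^ d, by positivity, fun n hn => ?_⟩
  set N := K * n with hN
  have hN1 : 1 ≤ N := Nat.mul_pos (by omega) hn
  set J := Finset.range (n + 1) ×ˢ Fintype.piFinset fun _ : Fin d => Finset.Icc (-(N : ℤ)) N
  set F : ℕ × (Fin d → ℤ) → ℝ × E d := fun z =>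
    (z.1 / √(n : ℝ), WithLp.toLp 2 fun j => (z.2 j : ℝ) / √(n : ℝ))
  have hn' : (1 : ℝ) ≤ n := by exact_mod_cast hn
  -- A crude count with `n` in place of `√n` suffices, as cardinality enters only through its
  -- logarithm.
  have hsn : √(n : ℝ) ≤ n := Real.sqrt_le_iff.2 ⟨by positivity, by nlinarith⟩
  have hsub : grid d M n ⊆ ↑(J.image F) := by
    rintro ⟨a, μ⟩ ⟨⟨i, -, hi2, hi3⟩, hμ⟩
    have hj : ∀ j, ∃ z : ℤ, z ∈ Finset.Icc (-(N : ℤ)) N ∧ μ j = z / √(n : ℝ) := fun j => by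
      obtain ⟨k, -, hk2, hk3⟩ := hμ j
      have hkN : k ≤ N := by
        have : (k : ℝ) ≤ N := hk2.trans <| by
          rw [hN, hK]
          push_cast
          have := Nat.le_ceil M
          gcongr
          linarith
        exact_mod_cast this
      rcases hk3 with h | h
      · exact ⟨k, Finset.mem_Icc.2 ⟨by omega, by omega⟩, by simpa using h⟩
      · refine ⟨-k, Finset.mem_Icc.2 ⟨by omega, by omega⟩, ?_⟩
        push_cast
        rw [neg_div]
        exact h
    choose z hz1 hz2 using hj
    refine Finset.mem_coe.2 (Finset.mem_image.2 ⟨(i, z), ?_, ?_⟩)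
    · refine Finset.mem_product.2 ⟨Finset.mem_range.2 ?_, Fintype.mem_piFinset.2 hz1⟩
      have : (i : ℝ) ≤ n := hi2.trans hsn
      have : i ≤ n := by exact_mod_cast this
      omega
    · refine Prod.ext hi3.symm ?_
      ext j
      exact (hz2 j).symm
  have hcard : ((J.image F).card : ℝ) ≤ 2 * (3 * K : ℝ) ^ d * (n : ℝ) ^ (d + 1) := by
    have h1 : (J.image F).card ≤ (n + 1) * (2 * N + 1) ^ d := by
      refine Finset.card_image_le.trans (le_of_eq ?_)
      have : ((N : ℤ) + 1 + N).toNat = 2 * N + 1 := by omega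
      simp [J, this]
    have h2 : (n + 1) * (2 * N + 1) ^ d ≤ (2 * n) * (3 * N) ^ d :=
      Nat.mul_le_mul (by omega) (Nat.pow_le_pow_left (by omega) d)
    calc ((J.image F).card : ℝ) ≤ (((2 * n) * (3 * N) ^ d : ℕ) : ℝ) := by exact_mod_cast h1.trans h2
      _ = _ := by
        rw [hN]
        push_cast
        ring
  have hfin : (grid d M n).Finite := (Finset.finite_toSet _).subset hsub
  refine ⟨hfin.toFinset, hfin.coe_toFinset, le_trans ?_ hcard⟩
  exact_mod_cast Finset.card_le_card fun p hp => Finset.mem_coe.1 (hsub (hfin.mem_toFinset.1 hp))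

theorem integral_sq_translate_sub_le {M : ℝ} {g : E d → ℝ}
    (hg : MemLp g 2 volume)
    (hlip : ∀ x, ∀ μ ∈ cube d M, |φ x - φ (x - μ)| ≤ ‖μ‖ * g x) {μ ν : E d}
    (hμν : ν - μ ∈ cube d M) :
    ∫ x, (φ (x - μ) - φ (x - ν)) ^ 2 ≤ ‖ν - μ‖ ^ 2 * ∫ x, g x ^ 2 := by
  rw [← integral_add_right_eq_self _ μ, ← integral_const_mul]
  refine integral_mono_of_nonneg (.of_forall fun _ => sq_nonneg _)
    (hg.integrable_sq.const_mul _) (.of_forall fun x => ?_)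
  have h1 : x + μ - ν = x - (ν - μ) := by abel
  have h2 : x + μ - μ = x := by abel
  simp only [h1, h2]
  rw [← mul_pow]
  exact sq_le_sq' (by linarith [(abs_le.1 (hlip x _ hμν)).1]) (abs_le.1 (hlip x _ hμν)).2

/-- Split the difference as `p.1` times a change of location plus `p.1 - θ.1` times `φ(· - θ.2) -
φ`. -/
theorem sqDist_le (h : MemLp φ 2 volume) (p θ : ℝ × E d) :
    sqDist φ p θ ≤ 2 * p.1 ^ 2 * (∫ x, (φ (x - p.2) - φ (x - θ.2)) ^ 2)
      + 8 * (p.1 - θ.1) ^ 2 * ∫ x, φ x ^ 2 := by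
  have e : ∫ x, φ (x - θ.2) ^ 2 = ∫ x, φ x ^ 2 :=
    integral_sub_right_eq_self (fun x => φ x ^ 2) θ.2
  have key := integral_le_add_add (memLp_mixture_sub h p θ).integrable_sq
    (((memLp_translate h p.2).sub (memLp_translate h θ.2)).integrable_sq.const_mul (2 * p.1 ^ 2))
    ((memLp_translate h θ.2).integrable_sq.const_mul (4 * (p.1 - θ.1) ^ 2))
    (h.integrable_sq.const_mul (4 * (p.1 - θ.1) ^ 2)) fun x => by
      simp only [mixture, Pi.sub_apply]
      have h1 : ∀ y z : ℝ, (y + z) ^ 2 ≤ 2 * (y ^ 2 + z ^ 2) := fun y z => by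
        nlinarith [sq_nonneg (y - z)]
      have h2 : (φ (x - θ.2) - φ x) ^ 2 ≤ 2 * (φ (x - θ.2) ^ 2 + φ x ^ 2) := by
        nlinarith [sq_nonneg (φ (x - θ.2) + φ x)]
      have h3 := mul_le_mul_of_nonneg_left h2 (sq_nonneg (p.1 - θ.1))
      calc _ = (p.1 * (φ (x - p.2) - φ (x - θ.2)) + (p.1 - θ.1) * (φ (x - θ.2) - φ x)) ^ 2 := by
            ring
        _ ≤ _ := h1 _ _
        _ ≤ _ := by
          rw [mul_pow, mul_pow]
          linarith
  rw [integral_const_mul, integral_const_mul, integral_const_mul, e] at key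
  simp only [Pi.sub_apply] at key
  rw [sqDist]
  linarith

/-- The bias of the grid is of order `1 / n` in squared `L²` distance. -/
theorem exists_forall_mem_grid_sqDist_le (h : MemLp φ 2 volume) {M : ℝ}
    (hLip : LipAssumption M φ) :
    ∃ C : ℝ, 0 < C ∧ ∀ n : ℕ, 1 ≤ n → 1 ≤ M * √(n : ℝ) → ∀ θ : ℝ × E d, 0 ≤ θ.1 → θ.1 ≤ 1 →
      θ.2 ∈ cube d M → ∃ q ∈ grid d M n, sqDist φ q θ ≤ C / n := by
  obtain ⟨g, hg, hlip, -⟩ := hLip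
  have hG0 : 0 ≤ ∫ x, g x ^ 2 := integral_nonneg fun _ => sq_nonneg _
  have hΦ0 : 0 ≤ ∫ x, φ x ^ 2 := integral_nonneg fun _ => sq_nonneg _
  refine ⟨2 * d * (∫ x, g x ^ 2) + 8 * (∫ x, φ x ^ 2) + 1, by positivity,
    fun n hn hMn θ h0 h1 hθ => ?_⟩
  have hn' : (0 : ℝ) < n := by exact_mod_cast hn
  have hs : 0 < √(n : ℝ) := Real.sqrt_pos.2 hn'
  obtain ⟨q, hq, hq1, hq2⟩ := exists_mem_grid_near hn hMn h0 h1 hθ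
  refine ⟨q, hq, (sqDist_le h q θ).trans ?_⟩
  have hss : (1 / √(n : ℝ)) ^ 2 = 1 / n := by rw [div_pow, Real.sq_sqrt hn'.le, one_pow]
  have hdiff : ∀ j, |(θ.2 - q.2) j| ≤ 1 / √(n : ℝ) := fun j => by
    rw [PiLp.sub_apply, abs_sub_comm]
    exact hq2 j
  have e1 := integral_sq_translate_sub_le hg hlip (μ := q.2) (ν := θ.2)
    fun j => (hdiff j).trans ((div_le_iff₀ hs).2 hMn)
  have e2 := norm_sq_le_of_forall_abs_le hdiff
  rw [hss] at e2
  have e3 : (q.1 - θ.1) ^ 2 ≤ 1 / n := by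
    rw [← hss, ← sq_abs]
    exact pow_le_pow_left₀ (abs_nonneg _) hq1 2
  have e4 : q.1 ^ 2 ≤ 1 := pow_le_one₀ (mem_grid_fst hq).1 (mem_grid_fst hq).2
  have e5 : 0 ≤ ∫ x, (φ (x - q.2) - φ (x - θ.2)) ^ 2 := integral_nonneg fun _ => sq_nonneg _
  calc 2 * q.1 ^ 2 * (∫ x, (φ (x - q.2) - φ (x - θ.2)) ^ 2)
        + 8 * (q.1 - θ.1) ^ 2 * ∫ x, φ x ^ 2
      ≤ 2 * 1 * ((d * (1 / n)) * ∫ x, g x ^ 2) + 8 * (1 / n) * ∫ x, φ x ^ 2 := by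
        gcongr
        exact e1.trans (by gcongr)
    _ ≤ _ := by
        rw [le_div_iff₀ hn']
        have : (2 * 1 * ((d * (1 / (n : ℝ))) * ∫ x, g x ^ 2) + 8 * (1 / n) * ∫ x, φ x ^ 2) * n
            = 2 * d * (∫ x, g x ^ 2) + 8 * ∫ x, φ x ^ 2 := by field_simp
        linarith

/-! ### Risk bound and transfer to the weight -/

/-- Risk bound in probability for the contrast estimator: outside an event of probability of
order `1 / n`, the squared `L²` distance is of order `log n / n`. -/
theorem exists_measureReal_sqDist_le (hφ : IsProbDensity φ) (hm : Measurable φ)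
    (h : MemLp φ 2 volume) {M : ℝ} (hM : 0 < M) (hd : 0 < d) (hLip : LipAssumption M φ) :
    ∃ C : ℝ, 0 < C ∧ ∀ n : ℕ, 2 ≤ n → ∀ est : (Fin n → E d) → ℝ × E d,
      IsContrastEstimator M φ n est → ∀ θ : ℝ × E d, 0 ≤ θ.1 → θ.1 ≤ 1 → θ.2 ∈ cube d M →
        ∃ S : Set (Fin n → E d), MeasurableSet S ∧
          (sampleLaw φ θ.1 θ.2 n).real S ≤ C / n ∧
          ∀ X ∉ S, sqDist φ (est X) θ ≤ C * Real.log n / n := by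
  obtain ⟨B, hB0, hB⟩ := hφ.exists_bound hM hLip
  obtain ⟨C₁, hC₁, hbias⟩ := exists_forall_mem_grid_sqDist_le h hLip
  obtain ⟨C₂, hC₂, hgrid⟩ := exists_finset_grid_subset d M
  -- With `t = A log n` each deviation set has probability at most `2 n ^ -(d + 2)`, which beats the
  -- `n ^ (d + 1)` grid points by a factor `n`.
  set A : ℝ := 8 * (B + 1) * (d + 2) with hA
  have hlog2 := Real.log_pos (one_lt_two (α := ℝ))
  have hA0 : 0 < A := by positivity
  refine ⟨2 * C₂ + (2 * C₁ / Real.log 2 + 6 * A), by positivity,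
    fun n hn est hest θ h0 h1 hθ => ?_⟩
  have hn2 : (2 : ℝ) ≤ n := by exact_mod_cast hn
  have hn0 : (0 : ℝ) < n := by linarith
  have hlog : Real.log 2 ≤ Real.log n := Real.log_le_log two_pos hn2
  have := isProbabilityMeasure_sampleLaw hφ h0 h1 n
  obtain ⟨G, hG, hcard⟩ := hgrid n (by omega)
  set t := A * Real.log n with ht
  refine ⟨⋃ p ∈ G, deviationSet φ θ p n t,
    G.measurableSet_biUnion fun p _ => measurableSet_deviationSet hm θ p n t, ?_, fun X hX => ?_⟩
  · have hexp : Real.exp (-(1 / (8 * (B + 1))) * t) = ((n : ℝ) ^ (d + 2))⁻¹ := by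
      have : -(1 / (8 * (B + 1))) * t = -(((d + 2 : ℕ) : ℝ) * Real.log n) := by
        rw [ht, hA]
        push_cast
        field_simp
      rw [this, Real.exp_neg, Real.exp_nat_mul, Real.exp_log hn0]
    calc (sampleLaw φ θ.1 θ.2 n).real (⋃ p ∈ G, deviationSet φ θ p n t)
        ≤ ∑ p ∈ G, (sampleLaw φ θ.1 θ.2 n).real (deviationSet φ θ p n t) :=
          measureReal_biUnion_finset_le _ _
      _ ≤ ∑ _p ∈ G, 2 * ((n : ℝ) ^ (d + 2))⁻¹ := by
          refine Finset.sum_le_sum fun p hp => ?_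
          have hp' := mem_grid_fst (hG ▸ Finset.mem_coe.2 hp)
          exact hexp ▸ measureReal_deviationSet_le hφ hm h hB0 hB h0 h1 hp'.1 hp'.2 n t
      _ = G.card * (2 * ((n : ℝ) ^ (d + 2))⁻¹) := by rw [Finset.sum_const, nsmul_eq_mul]
      _ ≤ C₂ * (n : ℝ) ^ (d + 1) * (2 * ((n : ℝ) ^ (d + 2))⁻¹) := by gcongr
      _ = 2 * C₂ / n := by
          rw [pow_succ _ (d + 1)]
          field_simp
      _ ≤ _ := by
          gcongr
          have : 0 ≤ 2 * C₁ / Real.log 2 + 6 * A := by positivity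
          linarith
  · have hX' : ∀ p ∈ grid d M n, X ∉ deviationSet φ θ p n t := fun p hp hXp =>
      hX (Set.mem_biUnion (Finset.mem_coe.1 (hG ▸ hp)) hXp)
    -- A grid point exists, and `0 < d` provides a coordinate whose index `k` satisfies `1 ≤ k ≤ M
    -- √n`.
    have hMn : 1 ≤ M * √(n : ℝ) := by
      obtain ⟨k, hk1, hk2, -⟩ := (hest.mem_grid X).2 ⟨0, hd⟩
      exact le_trans (by exact_mod_cast hk1) hk2
    obtain ⟨q, hq, hqD⟩ := hbias n (by omega) hMn θ h0 h1 hθ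
    have key := sqDist_le_of_notMem_deviationSet h (by omega) (hest.isMin X q hq)
      (hX' _ (hest.mem_grid X)) (hX' q hq)
    have e1 : 2 * C₁ ≤ 2 * C₁ / Real.log 2 * Real.log n := by
      rw [div_mul_eq_mul_div, le_div_iff₀ hlog2]
      gcongr
    have e2 : 0 ≤ 2 * C₂ * Real.log n := by positivity
    calc sqDist φ (est X) θ ≤ 2 * (C₁ / n) + 6 * (t / n) := by linarith
      _ = (2 * C₁ + 6 * A * Real.log n) / n := by rw [ht]; ring
      _ ≤ _ := by
          gcongr
          linarith

/-- If the `L²` distance is small compared to `ln`, then it controls the error on the weight. -/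
theorem norm_pow_four_mul_sq_le {M lamBar ln c D : ℝ} {n : ℕ} (hn : 0 < n)
    (h : MemLp φ 2 volume) (hc : 0 < c) {p θ : ℝ × E d}
    (hcF : c * ‖θ.2‖ ^ 4 ≤ secondDiff φ θ.2) (hp : 0 ≤ p.1)
    (hθ : θ ∈ paramSet d M lamBar ln n) (hD : sqDist φ p θ ≤ D / n) (hln : 0 ≤ ln)
    (hlnD : 18 / c * D < ln ^ 2) :
    ‖θ.2‖ ^ 4 * (p.1 - θ.1) ^ 2 ≤ 18 / c * D / n := by
  obtain ⟨h0, -, hne, hl, -, -⟩ := hθ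
  have hn' : (0 : ℝ) < n := by exact_mod_cast hn
  have hs : 0 < √(n : ℝ) := Real.sqrt_pos.2 hn'
  have hν : 0 < ‖θ.2‖ := norm_pos_iff.2 hne
  have key : ‖θ.2‖ ^ 4 * min |p.1 - θ.1| θ.1 ^ 2 ≤ 18 / c * D / n := by
    have h1 : c * (‖θ.2‖ ^ 4 * min |p.1 - θ.1| θ.1 ^ 2) ≤ 18 * (D / n) := by
      calc c * (‖θ.2‖ ^ 4 * min |p.1 - θ.1| θ.1 ^ 2)
          = min |p.1 - θ.1| θ.1 ^ 2 * (c * ‖θ.2‖ ^ 4) := by ring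
        _ ≤ min |p.1 - θ.1| θ.1 ^ 2 * secondDiff φ θ.2 := by gcongr
        _ ≤ 18 * sqDist φ p θ := min_sq_mul_secondDiff_le h hp h0 _ _
        _ ≤ _ := by gcongr
    have h2 : 18 / c * D / n = 18 * (D / n) / c := by ring
    rw [h2, le_div_iff₀ hc]
    linarith
  rcases le_or_gt |p.1 - θ.1| θ.1 with hcase | hcase
  · rwa [min_eq_left hcase, sq_abs] at key
  -- Here the minimum is the true weight, so `‖θ.2‖ ^ 4 * θ.1 ^ 2 * n ≤ 18 / c * D < ln ^ 2`,
  -- against the lower bound on the weight in `paramSet`.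
  · exfalso
    rw [min_eq_right hcase.le, le_div_iff₀ hn'] at key
    rw [div_le_iff₀ (by positivity)] at hl
    have h3 := pow_le_pow_left₀ hln hl 2
    have h4 : (θ.1 * (‖θ.2‖ ^ 2 * √(n : ℝ))) ^ 2 = ‖θ.2‖ ^ 4 * θ.1 ^ 2 * n := by
      rw [mul_pow, mul_pow, Real.sq_sqrt hn'.le]
      ring
    linarith

theorem integral_le_add_mul_measureReal {Ω : Type*} [MeasurableSpace Ω] {P : Measure Ω}
    [IsProbabilityMeasure P] {Y : Ω → ℝ} (hY : Integrable Y P) {S : Set Ω}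
    (hS : MeasurableSet S) {a W : ℝ} (ha : 0 ≤ a) (hW : ∀ X, Y X ≤ W) (h : ∀ X ∉ S, Y X ≤ a) :
    ∫ X, Y X ∂P ≤ a + W * P.real S := by
  have hi : Integrable (S.indicator fun _ => W) P := (integrable_const W).indicator hS
  have key : ∫ X, Y X ∂P ≤ ∫ X, ((fun _ => a) + S.indicator fun _ => W : Ω → ℝ) X ∂P := by
    refine integral_mono hY ((integrable_const a).add hi) fun X => ?_
    rw [Pi.add_apply]
    by_cases hX : X ∈ S
    · rw [Set.indicator_of_mem hX]
      linarith [hW X]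
    · rw [Set.indicator_of_notMem hX, add_zero]
      exact h X hX
  rw [integral_add' (integrable_const a) hi, integral_indicator hS] at key
  simp only [integral_const, smul_eq_mul, probReal_univ, measureReal_restrict_apply_univ,
    one_mul] at key
  linarith [mul_comm W (P.real S)]

end Contamination

/-! ### The risk in expectation -/

theorem mainTheorem2 (d : ℕ) (M lamBar : ℝ) (hM : 0 < M)
    (hlamBar_pos : 0 < lamBar) (hlamBar_lt : lamBar < 1)
    (φ : Contamination.E d → ℝ) (hφ : Contamination.IsProbDensity φ)
    (hS : Contamination.SmoothAssumption φ) (hLip : Contamination.LipAssumption M φ)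
    (l : ℕ → ℝ) (hl : Tendsto (fun n : ℕ => l n / Real.log n) atTop atTop) :
    ∃ C₂ : ℝ, 0 < C₂ ∧ ∀ n : ℕ, 2 ≤ n →
      ∀ est : (Fin n → Contamination.E d) → ℝ × Contamination.E d,
        Contamination.IsContrastEstimator M φ n est →
        ∀ θ ∈ Contamination.paramSet d M lamBar (l n) n,
          Integrable (fun X => ‖θ.2‖ ^ 4 * ((est X).1 - θ.1) ^ 2)
            (Contamination.sampleLaw φ θ.1 θ.2 n) ∧
          ∫ X, ‖θ.2‖ ^ 4 * ((est X).1 - θ.1) ^ 2 ∂(Contamination.sampleLaw φ θ.1 θ.2 n)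
            ≤ C₂ * Real.log n ^ 2 / n := by
  open Contamination in
  obtain ⟨hsm, hφ2⟩ := hS
  have hm : Measurable φ := hsm.continuous.measurable
  rcases Nat.eq_zero_or_pos d with rfl | hd
  -- In dimension `0` there is no nonzero `μ`, so the parameter set is empty.
  · exact ⟨1, one_pos, fun n _ est _ θ hθ => absurd (Subsingleton.elim _ _) hθ.2.2.1⟩
  obtain ⟨c, hc, hcF⟩ := exists_mul_norm_pow_four_le_secondDiff hφ2
    (hφ.integral_sq_pos hφ2) √(d * M ^ 2)
  obtain ⟨C, hC, hrisk⟩ := exists_measureReal_sqDist_le hφ hm hφ2 hM hd hLip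
  have hL2 : 0 < Real.log 2 := Real.log_pos one_lt_two
  set K := 18 / c * C / Real.log 2 with hK
  have hK0 : 0 < K := by positivity
  -- Beyond `n₀`, `ℓ_n ≥ (K + 1) log n`, so `ℓ_n ^ 2` exceeds `K log² n`, which dominates the order
  -- `log n` bound of the good event.
  obtain ⟨n₀, hn₀⟩ := eventually_atTop.1 (hl.eventually_ge_atTop (K + 1))
  set W := (d * M ^ 2) ^ 2 with hW
  have hW0 : 0 ≤ W := by positivity
  -- The three terms pay for the good event, the bad event (loss at most `W`, probability at most `C
  -- / n`) and the sample sizes below `n₀`; dividing by `log² 2` uses `n ≥ 2`.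
  refine ⟨K + W * C / Real.log 2 ^ 2 + W * n₀ / Real.log 2 ^ 2, by positivity,
    fun n hn est hest θ hθ => ?_⟩
  have hn2 : (2 : ℝ) ≤ n := by exact_mod_cast hn
  have hn0 : (0 : ℝ) < n := by linarith
  have hlog : Real.log 2 ≤ Real.log n := Real.log_le_log two_pos hn2
  have hlogsq : Real.log 2 ^ 2 ≤ Real.log n ^ 2 := pow_le_pow_left₀ hL2.le hlog 2
  have hLn : 0 < Real.log n := hL2.trans_le hlog
  obtain ⟨h0, h1, -, -, -, hcube⟩ := id hθ
  have hprob := isProbabilityMeasure_sampleLaw hφ h0.le h1.le n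
  have hnorm : ‖θ.2‖ ^ 2 ≤ d * M ^ 2 := norm_sq_le_of_forall_abs_le hcube
  have hYW : ∀ X, ‖θ.2‖ ^ 4 * ((est X).1 - θ.1) ^ 2 ≤ W := fun X => by
    obtain ⟨e0, e1⟩ := mem_grid_fst (hest.mem_grid X)
    have h2 : ((est X).1 - θ.1) ^ 2 ≤ 1 := by
      rw [sq_le_one_iff_abs_le_one, abs_le]
      constructor <;> linarith
    calc ‖θ.2‖ ^ 4 * ((est X).1 - θ.1) ^ 2 ≤ ‖θ.2‖ ^ 4 * 1 := by gcongr
      _ = (‖θ.2‖ ^ 2) ^ 2 := by ring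
      _ ≤ W := pow_le_pow_left₀ (sq_nonneg _) hnorm 2
  have hint : Integrable (fun X => ‖θ.2‖ ^ 4 * ((est X).1 - θ.1) ^ 2)
      (sampleLaw φ θ.1 θ.2 n) :=
    integrable_of_forall_abs_le
      (((hest.measurable.fst.sub_const _).pow_const 2).const_mul _) (c := W) fun X => by
        rw [abs_of_nonneg (by positivity)]
        exact hYW X
  refine ⟨hint, ?_⟩
  rw [le_div_iff₀ hn0]
  have hA : 0 ≤ K * Real.log n ^ 2 := by positivity
  have hA1 : 0 ≤ W * C / Real.log 2 ^ 2 * Real.log n ^ 2 := by positivity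
  have hA2 : 0 ≤ W * n₀ / Real.log 2 ^ 2 * Real.log n ^ 2 := by positivity
  have hscale : ∀ y : ℝ, 0 ≤ y → y ≤ y / Real.log 2 ^ 2 * Real.log n ^ 2 := fun y hy => by
    rw [div_mul_eq_mul_div, le_div_iff₀ (by positivity)]
    gcongr
  rcases lt_or_ge n n₀ with hnn | hnn
  · have h3 := integral_mono hint (integrable_const W) hYW
    simp only [integral_const, probReal_univ, one_smul] at h3
    have h4 : W * n ≤ W * n₀ := by gcongr
    have h5 := mul_le_mul_of_nonneg_right h3 hn0.le
    linarith [hscale (W * n₀) (by positivity)]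
  · obtain ⟨S, hSm, hSP, hSD⟩ := hrisk n hn est hest θ h0.le h1.le hcube
    have hln := hn₀ n hnn
    rw [le_div_iff₀ hLn] at hln
    have hln0 : 0 ≤ l n := le_trans (by positivity) hln
    have hKlog : 18 / c * (C * Real.log n) = K * (Real.log 2 * Real.log n) := by
      rw [hK]
      field_simp
    have hlnD : 18 / c * (C * Real.log n) < l n ^ 2 := by
      calc 18 / c * (C * Real.log n) = K * (Real.log 2 * Real.log n) := hKlog
        _ ≤ K * (Real.log n * Real.log n) := by gcongr
        _ < ((K + 1) * Real.log n) ^ 2 := by nlinarith [mul_pos hLn hLn]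
        _ ≤ l n ^ 2 := pow_le_pow_left₀ (by positivity) hln 2
    have hθR : ‖θ.2‖ ≤ √(d * M ^ 2) := Real.le_sqrt_of_sq_le hnorm
    have key := integral_le_add_mul_measureReal hint hSm
      (a := 18 / c * (C * Real.log n) / n) (by positivity) hYW fun X hX =>
        norm_pow_four_mul_sq_le (by omega) hφ2 hc (hcF _ hθR)
          (mem_grid_fst (hest.mem_grid X)).1 hθ (hSD X hX) hln0 hlnD
    have h3 : W * (sampleLaw φ θ.1 θ.2 n).real S ≤ W * (C / n) := by gcongr
    have h4 := mul_le_mul_of_nonneg_right (key.trans (add_le_add_right h3 _)) hn0.le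
    have h5 : (18 / c * (C * Real.log n) / n + W * (C / n)) * n =
        18 / c * (C * Real.log n) + W * C := by field_simp
    have h6 : K * (Real.log 2 * Real.log n) ≤ K * Real.log n ^ 2 := by
      rw [sq]
      gcongr
    linarith [hscale (W * C) (by positivity)]
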